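/- **Theorem 3.12 (nonsymmetric trisuccessor theorem).** Let $\mathbf k$ be a field, and let $\mathcal P=\mathcal T_{ns}(V)/(R)$ be a binary quadratic nonsymmetric operad over $\mathbf k$: here $V$ is a vector space placed in arity $2$, $\mathcal T_{ns}(V)=\bigoplus_t t[V]$ is the free nonsymmetric operad on $V$ (the sum runs over planar binary rooted trees $t$ and $t[V]$ is the tensor product of copies of $V$ indexed by the vertices of $t$), $R$ is a subspace of $\mathcal T_{ns}(V)_3$, and $(R)$ is the operadic ideal generated by $R$. Write $\widehat V=V\otimes(\mathbf k{\prec}\oplus\mathbf k{\succ}\oplus\mathbf k\,\cdot)$ and $\star={\prec}+{\succ}+{\cdot}$. For a tree $\tau$ with vertices labelled by elements of $V$, let $\widehat\tau\in\mathcal T_{ns}(\widehat V)$ be obtained by replacing each label $\omega$ by $\omega\otimes\star$. For a nonempty set $J$ of leaves of $\tau$, define $\mathrm{TSu}_J(\tau)\in\mathcal T_{ns}(\widehat V)$ recursively: $\mathrm{TSu}_J(|)=|$ for the trivial tree, and for $\tau=\tau_\ell\vee_\omega\tau_r$ (root label $\omega$, left and right subtrees $\tau_\ell,\tau_r$, with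 leaf sets $L(\tau_\ell)$, $L(\tau_r)$), $$\mathrm{TSu}_J(\tau)=\begin{cases}\mathrm{TSu}_J(\tau_\ell)\vee_{\omega\otimes\prec}\widehat{\tau_r}, & J\subseteq L(\tau_\ell),\\ \widehat{\tau_\ell}\vee_{\omega\otimes\succ}\mathrm{TSu}_J(\tau_r), & J\subseteq L(\tau_r),\\ \mathrm{TSu}_{J\cap L(\tau_\ell)}(\tau_\ell)\vee_{\omega\otimes\cdot}\mathrm{TSu}_{J\cap L(\tau_r)}(\tau_r), & \text{otherwise.}\end{cases}$$ Extend $\mathrm{TSu}_J$ linearly to $\mathcal T_{ns}(V)_n\to\mathcal T_{ns}(\widehat V)_n$ for each nonempty $J\subseteq\{1,\dots,n\}$. The trisuccessor of $\mathcal P$ is $$\mathrm{TSu}(\mathcal P)=\mathcal T_{ns}(\widehat V)\big/\big(\mathrm{TSu}_J(r):\ r\in R,\ \emptyset\ne J\subseteq\{1,2,3\}\big).$$ Encode a pair $(f,g)\in (V\otimes V)\oplus (V\otimes V)$, $f=\sum_i a_i\otimes b_i$, $g=\sum_j c_j\otimes d_j$, as the element $[f,g]=\sum_i (x\,b_i\,y)\,a_i\,z-\sum_j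 x\,c_j\,(y\,d_j\,z)$ of $\mathcal T_{ns}(V)_3$; this identifies $(V\otimes V)\oplus(V\otimes V)$ with $\mathcal T_{ns}(V)_3$. The black square product of two binary quadratic nonsymmetric operads is $$\mathcal T_{ns}(V)/(R)\ \blacksquare\ \mathcal T_{ns}(W)/(S)=\mathcal T_{ns}(V\otimes W)\big/\big([f_1\boxdot f_2,\;g_1\boxdot g_2]:\ [f_1,g_1]\in R,\ [f_2,g_2]\in S\big),$$ where $\boxdot$ is the bilinear map with $(a\otimes b)\boxdot(a'\otimes b')=(a\otimes a')\otimes(b\otimes b')$. Let $\mathit{TriDend}$ be the operad of tridendriform algebras, with generating operations $\prec,\succ,\cdot$ and relations $$(x\prec y)\prec z=x\prec(y\star z),\quad (x\succ y)\prec z=x\succ(y\prec z),\quad (x\star y)\succ z=x\succ(y\succ z),$$ $$(x\succ y)\cdot z=x\succ(y\cdot z),\quad (x\prec y)\cdot z=x\cdot(y\succ z),\quad (x\cdot y)\prec z=x\cdot(y\prec z),\quad (x\cdot y)\cdot z=x\cdot(y\cdot z).$$ Then there is an isomorphism of nonsymmetric operads $$\mathrm{TSu}(\mathcal P)\;\cong\;\mathit{TriDend}\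 \blacksquare\ \mathcal P .$$ -/

import Mathlib

open scoped TensorProduct DirectSum

noncomputable section

namespace NSOp

universe u v w x

/-! ## Nonsymmetric operads -/

/-- A nonsymmetric operad over `k`, presented by partial compositions. Inputs are numbered from
`0`, so `comp i` is the operation usually written `∘_{i+1} : P_m ⊗ P_n → P_{m+n-1}`; the target
arity is an explicit parameter `l` with `l + 1 = m + n`. -/
structure NSOperad (k : Type u) [Field k] where
  obj : ℕ → Type w
  [acg : ∀ n, AddCommGroup (obj n)]
  [mod : ∀ n, Module k (obj n)]
  one : obj 1
  comp : ∀ {m n l : ℕ} (i : ℕ), i < m → l + 1 = m + n → (obj m →ₗ[k] obj n →ₗ[k] obj l)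
  one_comp : ∀ {n : ℕ} (h0 : 0 < 1) (h : n + 1 = 1 + n) (y : obj n), comp 0 h0 h one y = y
  comp_one : ∀ {n : ℕ} (i : ℕ) (hi : i < n) (h : n + 1 = n + 1) (y : obj n),
    comp i hi h y one = y
  /-- `(x ∘_i y) ∘_{i+j} z = x ∘_i (y ∘_j z)` -/
  comp_seq : ∀ {m n p a b l : ℕ} (i j : ℕ) (hi : i < m) (hj : j < n) (hij : i + j < a)
    (h₁ : a + 1 = m + n) (h₂ : l + 1 = a + p) (h₃ : b + 1 = n + p) (h₄ : l + 1 = m + b)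
    (x : obj m) (y : obj n) (z : obj p),
    comp (i + j) hij h₂ (comp i hi h₁ x y) z = comp i hi h₄ x (comp j hj h₃ y z)
  /-- `(x ∘_i y) ∘_{j+n-1} z = (x ∘_j z) ∘_i y` for `i < j`, with `y` of arity `n` -/
  comp_par : ∀ {m n p a b l : ℕ} (i j q : ℕ) (_ : i < j) (_ : q + 1 = j + n)
    (hi : i < m) (hj : j < m) (hqa : q < a) (hib : i < b)
    (h₁ : a + 1 = m + n) (h₂ : l + 1 = a + p) (h₃ : b + 1 = m + p) (h₄ : l + 1 = b + n)
    (x : obj m) (y : obj n) (z : obj p),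
    comp q hqa h₂ (comp i hi h₁ x y) z = comp i hib h₄ (comp j hj h₃ x z) y

attribute [instance] NSOperad.acg NSOperad.mod

variable {k : Type u} [Field k]

/-- An isomorphism of nonsymmetric operads. -/
structure NSOperad.Iso (P : NSOperad.{u, w} k) (Q : NSOperad.{u, x} k) where
  toEquiv : ∀ n, P.obj n ≃ₗ[k] Q.obj n
  map_one : toEquiv 1 P.one = Q.one
  map_comp : ∀ {m n l : ℕ} (i : ℕ) (hi : i < m) (h : l + 1 = m + n) (x : P.obj m) (y : P.obj n),
    toEquiv l (P.comp i hi h x y) = Q.comp i hi h (toEquiv m x) (toEquiv n y)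

namespace NSOperad

/-- Membership in the operadic ideal generated by a family `S` of elements. -/
inductive InIdeal (P : NSOperad.{u, w} k) (S : ∀ n, Set (P.obj n)) : ∀ n, P.obj n → Prop
  | of {n : ℕ} {x : P.obj n} (hx : x ∈ S n) : InIdeal P S n x
  | zero (n : ℕ) : InIdeal P S n 0
  | add {n : ℕ} {x y : P.obj n} (hx : InIdeal P S n x) (hy : InIdeal P S n y) :
      InIdeal P S n (x + y)
  | smul {n : ℕ} (c : k) {x : P.obj n} (hx : InIdeal P S n x) : InIdeal P S n (c • x)
  | comp_left {m n l : ℕ} (i : ℕ) (hi : i < m) (h : l + 1 = m + n) {x : P.obj m} (y : P.obj n)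
      (hx : InIdeal P S m x) : InIdeal P S l (P.comp i hi h x y)
  | comp_right {m n l : ℕ} (i : ℕ) (hi : i < m) (h : l + 1 = m + n) (x : P.obj m) {y : P.obj n}
      (hy : InIdeal P S n y) : InIdeal P S l (P.comp i hi h x y)

/-- The operadic ideal generated by `S`. -/
def ideal (P : NSOperad.{u, w} k) (S : ∀ n, Set (P.obj n)) (n : ℕ) : Submodule k (P.obj n) where
  carrier := {x | InIdeal P S n x}
  zero_mem' := .zero n
  add_mem' := .add
  smul_mem' c _ hx := .smul c hx

/-- Partial composition on the quotient by an operadic ideal. -/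
def quotComp (P : NSOperad.{u, w} k) (S : ∀ n, Set (P.obj n)) {m n l : ℕ} (i : ℕ) (hi : i < m)
    (h : l + 1 = m + n) :
    (P.obj m ⧸ P.ideal S m) →ₗ[k] (P.obj n ⧸ P.ideal S n) →ₗ[k] (P.obj l ⧸ P.ideal S l) :=
  Submodule.liftQ _
    (LinearMap.flip (Submodule.liftQ _
      (LinearMap.flip ((P.comp i hi h).compr₂ (P.ideal S l).mkQ))
      (by
        intro y hy
        ext x
        exact (Submodule.Quotient.mk_eq_zero _).2 (InIdeal.comp_right i hi h x hy))))
    (by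
      intro x hx
      ext y
      exact (Submodule.Quotient.mk_eq_zero _).2 (InIdeal.comp_left i hi h y hx))

/-- The quotient `P/(S)` of a nonsymmetric operad by the ideal generated by `S`. -/
def quotient (P : NSOperad.{u, w} k) (S : ∀ n, Set (P.obj n)) : NSOperad.{u, w} k where
  obj n := P.obj n ⧸ P.ideal S n
  one := Submodule.Quotient.mk P.one
  comp i hi h := P.quotComp S i hi h
  one_comp h0 h y := by
    induction y using Submodule.Quotient.induction_on with
    | H y => exact congrArg Submodule.Quotient.mk (P.one_comp h0 h y)
  comp_one i hi h y := by
    induction y using Submodule.Quotient.induction_on with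
    | H y => exact congrArg Submodule.Quotient.mk (P.comp_one i hi h y)
  comp_seq i j hi hj hij h₁ h₂ h₃ h₄ x y z := by
    induction x using Submodule.Quotient.induction_on with
    | H x =>
    induction y using Submodule.Quotient.induction_on with
    | H y =>
    induction z using Submodule.Quotient.induction_on with
    | H z => exact congrArg Submodule.Quotient.mk (P.comp_seq i j hi hj hij h₁ h₂ h₃ h₄ x y z)
  comp_par i j q hlt hq hi hj hqa hib h₁ h₂ h₃ h₄ x y z := by
    induction x using Submodule.Quotient.induction_on with
    | H x =>
    induction y using Submodule.Quotient.induction_on with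
    | H y =>
    induction z using Submodule.Quotient.induction_on with
    | H z =>
      exact congrArg Submodule.Quotient.mk
        (P.comp_par i j q hlt hq hi hj hqa hib h₁ h₂ h₃ h₄ x y z)

end NSOperad

/-! ## The free nonsymmetric operad on a vector space of binary operations -/

/-- Planar binary rooted trees; `nil` is the trivial tree, with one leaf. -/
abbrev PTree := BinaryTree Unit

section Free

variable (k) (V : Type v) [AddCommGroup V] [Module k V]

/-- The treewise tensor module `t[V]`: one tensor factor `V` for each vertex of `t`. The factor of
the root comes first, then those of the left and of the right subtree. -/
def TMod : PTree → ModuleCat.{max u v} k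
  | .nil => ModuleCat.of k (ULift.{max u v} k)
  | .node _ l r => ModuleCat.of k (V ⊗[k] (TMod l ⊗[k] TMod r))

/-- `|[V] = k`. -/
def TMod.leafEquiv : TMod k V .nil ≃ₗ[k] k := ULift.moduleEquiv

/-- `(l ∨ r)[V] = V ⊗ (l[V] ⊗ r[V])`. -/
def TMod.nodeEquiv (l r : PTree) :
    TMod k V (.node () l r) ≃ₗ[k] V ⊗[k] (TMod k V l ⊗[k] TMod k V r) :=
  LinearEquiv.refl k _

/-- The total space `⨁_t t[V]` of the free nonsymmetric operad on `V = V_2`. -/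
abbrev FreeTotal : Type (max u v) := ⨁ t : PTree, TMod k V t

/-- The component `T_ns(V)_n`, the sum of the `t[V]` over the trees `t` with `n` leaves. -/
def FreeTotal.arity (n : ℕ) : Submodule k (FreeTotal k V) where
  carrier := {x | ∀ t : PTree, t.numLeaves ≠ n → x t = 0}
  zero_mem' := fun _ _ => rfl
  add_mem' := by
    intro a b ha hb t ht
    rw [DirectSum.add_apply, ha t ht, hb t ht, add_zero]
  smul_mem' := by
    intro c a ha t ht
    rw [DirectSum.smul_apply, ha t ht, smul_zero]

/-- The trivial tree, as an element of the free operad. -/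
def FreeTotal.leaf : FreeTotal k V :=
  DirectSum.lof k PTree (fun t => TMod k V t) .nil ((TMod.leafEquiv k V).symm 1)

/-- Grafting as a linear map: `v ⊗ (x ⊗ y) ↦ x ∨_v y`. -/
def FreeTotal.graftT : V ⊗[k] (FreeTotal k V ⊗[k] FreeTotal k V) →ₗ[k] FreeTotal k V :=
  (DirectSum.toModule k (PTree × PTree) (FreeTotal k V) fun p =>
      (DirectSum.lof k PTree (fun t => TMod k V t) (.node () p.1 p.2)) ∘ₗ
        (TMod.nodeEquiv k V p.1 p.2).symm.toLinearMap) ∘ₗ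
    (TensorProduct.directSumRight k k V
      (fun p : PTree × PTree => TMod k V p.1 ⊗[k] TMod k V p.2)).toLinearMap ∘ₗ
    (TensorProduct.map LinearMap.id
      (TensorProduct.directSum k k (fun t => TMod k V t) (fun t => TMod k V t)).toLinearMap)

variable {k V}

namespace FreeTotal

/-- The inclusion of `t[V]`. -/
def incl (t : PTree) : TMod k V t →ₗ[k] FreeTotal k V :=
  DirectSum.lof k PTree (fun t => TMod k V t) t

/-- The grafting `x ∨_v y`. -/
def graft (v : V) (x y : FreeTotal k V) : FreeTotal k V := graftT k V (v ⊗ₜ (x ⊗ₜ y))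

/-- Substitution of `y` for the leaf number `i` of a tree tensor, by recursion on the tree. -/
def compAux (y : FreeTotal k V) : (t : PTree) → ℕ → (TMod k V t →ₗ[k] FreeTotal k V)
  | .nil, _ => (LinearMap.toSpanSingleton k _ y) ∘ₗ (TMod.leafEquiv k V).toLinearMap
  | .node _ l r, i =>
    if i < l.numLeaves then
      graftT k V ∘ₗ
        TensorProduct.map LinearMap.id (TensorProduct.map (compAux y l i) (incl r)) ∘ₗ
          (TMod.nodeEquiv k V l r).toLinearMap
    else
      graftT k V ∘ₗ
        TensorProduct.map LinearMap.id
          (TensorProduct.map (incl l) (compAux y r (i - l.numLeaves))) ∘ₗ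
            (TMod.nodeEquiv k V l r).toLinearMap

/-- `x ∘_i y`, linear in `x`. -/
def compRight (i : ℕ) (y : FreeTotal k V) : FreeTotal k V →ₗ[k] FreeTotal k V :=
  DirectSum.toModule k PTree _ fun t => compAux y t i

theorem graftT_incl (v : V) (l r : PTree) (a : TMod k V l) (b : TMod k V r) :
    graft v (incl l a) (incl r b) =
      incl (.node () l r) ((TMod.nodeEquiv k V l r).symm (v ⊗ₜ (a ⊗ₜ b))) := by
  simp only [graft, graftT, LinearMap.comp_apply, TensorProduct.map_tmul, LinearMap.id_apply,
    incl, LinearEquiv.coe_coe, TensorProduct.directSum_lof_tmul_lof]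
  erw [TensorProduct.directSumRight_tmul_lof, DirectSum.toModule_lof]
  rfl

theorem graft_add_left (v : V) (a b y : FreeTotal k V) :
    graft v (a + b) y = graft v a y + graft v b y := by
  simp [graft, TensorProduct.add_tmul, TensorProduct.tmul_add]

theorem graft_add_right (v : V) (x a b : FreeTotal k V) :
    graft v x (a + b) = graft v x a + graft v x b := by
  simp [graft, TensorProduct.tmul_add]

theorem graft_smul_left (c : k) (v : V) (x y : FreeTotal k V) :
    graft v (c • x) y = c • graft v x y := by
  rw [graft, graft, ← TensorProduct.smul_tmul', TensorProduct.tmul_smul, map_smul]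

theorem graft_smul_right (c : k) (v : V) (x y : FreeTotal k V) :
    graft v x (c • y) = c • graft v x y := by
  simp [graft, TensorProduct.tmul_smul]

theorem graft_add_vec (v w : V) (x y : FreeTotal k V) :
    graft (v + w) x y = graft v x y + graft w x y := by
  simp [graft, TensorProduct.add_tmul]

theorem graft_smul_vec (c : k) (v : V) (x y : FreeTotal k V) :
    graft (c • v) x y = c • graft v x y := by
  rw [graft, graft, ← TensorProduct.smul_tmul', map_smul]

theorem graft_zero_left (v : V) (y : FreeTotal k V) : graft v 0 y = 0 := by
  simp [graft]

theorem graft_zero_right (v : V) (x : FreeTotal k V) : graft v x 0 = 0 := by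
  simp [graft]

theorem incl_mem (t : PTree) (a : TMod k V t) : incl t a ∈ arity k V t.numLeaves := by
  intro s hs
  rw [incl, DirectSum.lof_eq_of, DirectSum.of_eq_of_ne]
  rintro rfl
  exact hs rfl

theorem leaf_mem : leaf k V ∈ arity k V 1 := incl_mem .nil _

/-- An element of arity `n` is a sum of tree tensors with `n` leaves. -/
theorem arity_induction_incl {n : ℕ} {p : FreeTotal k V → Prop} (h0 : p 0)
    (ha : ∀ x y, p x → p y → p (x + y))
    (hi : ∀ (t : PTree), t.numLeaves = n → ∀ a : TMod k V t, p (incl t a))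
    (x : FreeTotal k V) (hx : x ∈ arity k V n) : p x := by
  classical
  rw [← DirectSum.sum_support_of x]
  refine Finset.sum_induction _ p ha h0 fun t ht => ?_
  refine hi t ?_ _
  by_contra hne
  exact (DFinsupp.mem_support_iff.1 ht) (hx t hne)

theorem graft_mem {m n : ℕ} (v : V) {x y : FreeTotal k V} (hx : x ∈ arity k V m)
    (hy : y ∈ arity k V n) : graft v x y ∈ arity k V (m + n) := by
  refine arity_induction_incl (p := fun x => graft v x y ∈ arity k V (m + n)) ?_ ?_ ?_ x hx
  · simp only [graft_zero_left]; exact zero_mem _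
  · intro a b ha hb; rw [graft_add_left]; exact add_mem ha hb
  intro t ht a
  refine arity_induction_incl (p := fun y => graft v (incl t a) y ∈ arity k V (m + n))
    ?_ ?_ ?_ y hy
  · simp only [graft_zero_right]; exact zero_mem _
  · intro a b ha hb; rw [graft_add_right]; exact add_mem ha hb
  intro s hs b
  rw [graftT_incl, ← ht, ← hs]
  exact incl_mem (k := k) (V := V) (.node () t s) _

/-- The free operad is spanned by iterated graftings of trivial trees. -/
theorem arity_induction {p : ℕ → FreeTotal k V → Prop} (h0 : ∀ n, p n 0)
    (ha : ∀ n x y, p n x → p n y → p n (x + y)) (hl : ∀ c : k, p 1 (c • leaf k V))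
    (hg : ∀ m n (v : V) x y, x ∈ arity k V m → y ∈ arity k V n → p m x → p n y →
      p (m + n) (graft v x y))
    {n : ℕ} {x : FreeTotal k V} (hx : x ∈ arity k V n) : p n x := by
  have key : ∀ (t : PTree) (a : TMod k V t), p t.numLeaves (incl t a) := by
    intro t
    induction t with
    | nil =>
      intro a
      have : incl (k := k) (V := V) .nil a = (TMod.leafEquiv k V a) • leaf k V := by
        obtain ⟨c, rfl⟩ := (TMod.leafEquiv k V).symm.surjective a
        rw [LinearEquiv.apply_symm_apply]
        change incl (k := k) (V := V) .nil ((TMod.leafEquiv k V).symm c) =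
          c • incl (k := k) (V := V) .nil ((TMod.leafEquiv k V).symm 1)
        rw [← map_smul, ← map_smul, smul_eq_mul, mul_one]
      rw [this]
      exact hl _
    | node u l r ihl ihr =>
      intro a
      obtain ⟨b, rfl⟩ := (TMod.nodeEquiv k V l r).symm.surjective a
      induction b with
      | zero => rw [map_zero, map_zero]; exact h0 _
      | add x y hx hy => rw [map_add, map_add]; exact ha _ _ _ hx hy
      | tmul v c =>
        induction c with
        | zero => rw [TensorProduct.tmul_zero, map_zero, map_zero]; exact h0 _
        | add x y hx hy => rw [TensorProduct.tmul_add, map_add, map_add]; exact ha _ _ _ hx hy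
        | tmul c d =>
          rw [← graftT_incl]
          exact hg _ _ v _ _ (incl_mem _ _) (incl_mem _ _) (ihl c) (ihr d)
  refine arity_induction_incl (h0 n) (ha n) ?_ x hx
  rintro t rfl a
  exact key t a

theorem compRight_smul_leaf (i : ℕ) (c : k) (y : FreeTotal k V) :
    compRight i y (c • leaf k V) = c • y := by
  rw [map_smul, compRight, leaf, DirectSum.toModule_lof]
  simp [compAux]

theorem compRight_leaf (i : ℕ) (y : FreeTotal k V) : compRight i y (leaf k V) = y := by
  simpa using compRight_smul_leaf i 1 y

theorem compRight_incl (i : ℕ) (y : FreeTotal k V) (t : PTree) (a : TMod k V t) :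
    compRight i y (incl t a) = compAux y t i a := by
  rw [compRight, incl, DirectSum.toModule_lof]

theorem compRight_graft {m n : ℕ} (i : ℕ) (y : FreeTotal k V) (v : V) {a b : FreeTotal k V}
    (hx : a ∈ arity k V m) (hy : b ∈ arity k V n) :
    compRight i y (graft v a b) =
      if i < m then graft v (compRight i y a) b else graft v a (compRight (i - m) y b) := by
  refine arity_induction_incl (n := m) (p := fun a => compRight i y (graft v a b) =
      if i < m then graft v (compRight i y a) b else graft v a (compRight (i - m) y b))
      ?_ ?_ ?_ a hx
  · simp [graft_zero_left]
  · intro a a' h h'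
    rw [graft_add_left, map_add, h, h']
    split_ifs <;> simp [graft_add_left]
  rintro t rfl a
  refine arity_induction_incl (n := n) (p := fun b => compRight i y (graft v (incl t a) b) =
      if i < t.numLeaves then graft v (compRight i y (incl t a)) b
      else graft v (incl t a) (compRight (i - t.numLeaves) y b))
      ?_ ?_ ?_ b hy
  · simp [graft_zero_right]
  · intro a a' h h'
    rw [graft_add_right, map_add, h, h']
    split_ifs <;> simp [graft_add_right]
  rintro s rfl b
  rw [graftT_incl]
  simp only [compRight_incl, compAux]
  split_ifs <;> simp [graft]

theorem mem_arity_of_eq {m n : ℕ} {x : FreeTotal k V} (hx : x ∈ arity k V m) (h : m = n) :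
    x ∈ arity k V n := h ▸ hx

theorem compRight_mem {m n l i : ℕ} (hi : i < m) (h : l + 1 = m + n) {x y : FreeTotal k V}
    (hx : x ∈ arity k V m) (hy : y ∈ arity k V n) : compRight i y x ∈ arity k V l := by
  revert l i
  refine arity_induction (p := fun m x => ∀ {l i : ℕ}, i < m → l + 1 = m + n →
    compRight i y x ∈ arity k V l) ?_ ?_ ?_ ?_ hx
  · intros; rw [map_zero]; exact zero_mem _
  · intro m a b ha hb l i hi h
    rw [map_add]; exact add_mem (ha hi h) (hb hi h)
  · intro c l i hi h
    rw [compRight_smul_leaf]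
    exact Submodule.smul_mem _ _ (mem_arity_of_eq hy (by omega))
  · intro m m' v a b ha hb iha ihb l i hi h
    rw [compRight_graft i y v ha hb]
    split_ifs with hlt
    · obtain ⟨l', hl'⟩ : ∃ l', l' + 1 = m + n := ⟨m + n - 1, by omega⟩
      exact mem_arity_of_eq (graft_mem v (iha hlt hl') hb) (by omega)
    · obtain ⟨l', hl'⟩ : ∃ l', l' + 1 = m' + n := ⟨m' + n - 1, by omega⟩
      exact mem_arity_of_eq (graft_mem v ha (ihb (by omega) hl')) (by omega)

theorem compRight_add_right {m : ℕ} (i : ℕ) (y z : FreeTotal k V) {x : FreeTotal k V}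
    (hx : x ∈ arity k V m) : compRight i (y + z) x = compRight i y x + compRight i z x := by
  revert i
  refine arity_induction (p := fun m x => ∀ i, compRight i (y + z) x =
    compRight i y x + compRight i z x) ?_ ?_ ?_ ?_ hx
  · simp
  · intro m a b ha hb i
    rw [map_add, map_add, map_add, ha, hb]; abel
  · intro c i
    simp only [compRight_smul_leaf, smul_add]
  · intro m m' v a b ha hb iha ihb i
    simp only [compRight_graft i _ v ha hb, iha, ihb]
    split_ifs
    · rw [graft_add_left]
    · rw [graft_add_right]

theorem compRight_smul_right {m : ℕ} (i : ℕ) (c : k) (y : FreeTotal k V) {x : FreeTotal k V}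
    (hx : x ∈ arity k V m) : compRight i (c • y) x = c • compRight i y x := by
  revert i
  refine arity_induction (p := fun m x => ∀ i, compRight i (c • y) x = c • compRight i y x)
    ?_ ?_ ?_ ?_ hx
  · simp
  · intro m a b ha hb i
    rw [map_add, map_add, ha, hb, smul_add]
  · intro d i
    simp only [compRight_smul_leaf, smul_comm c d]
  · intro m m' v a b ha hb iha ihb i
    simp only [compRight_graft i _ v ha hb, iha, ihb]
    split_ifs
    · rw [graft_smul_left]
    · rw [graft_smul_right]

theorem compRight_right_leaf {m : ℕ} (i : ℕ) {x : FreeTotal k V} (hx : x ∈ arity k V m) :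
    compRight i (leaf k V) x = x := by
  revert i
  refine arity_induction (p := fun m x => ∀ i, compRight i (leaf k V) x = x) ?_ ?_ ?_ ?_ hx
  · simp
  · intro m a b ha hb i
    rw [map_add, ha, hb]
  · intro c i
    rw [compRight_smul_leaf]
  · intro m m' v a b ha hb iha ihb i
    rw [compRight_graft i _ v ha hb, iha, ihb, ite_self]

theorem compRight_seq {m n : ℕ} {i j : ℕ} (hi : i < m) (hj : j < n) {x y : FreeTotal k V}
    (z : FreeTotal k V) (hx : x ∈ arity k V m) (hy : y ∈ arity k V n) :
    compRight (i + j) z (compRight i y x) = compRight i (compRight j z y) x := by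
  revert i
  refine arity_induction (p := fun m x => ∀ {i : ℕ}, i < m →
    compRight (i + j) z (compRight i y x) = compRight i (compRight j z y) x) ?_ ?_ ?_ ?_ hx
  · simp
  · intro m a b ha hb i hi
    rw [map_add, map_add, map_add, ha hi, hb hi]
  · intro c i hi
    obtain rfl : i = 0 := by omega
    rw [compRight_smul_leaf, compRight_smul_leaf, map_smul, Nat.zero_add]
  · intro m m' v a b ha hb iha ihb i hi
    rw [compRight_graft i y v ha hb, compRight_graft i _ v ha hb]
    split_ifs with hlt
    · obtain ⟨q, hq⟩ : ∃ q, q + 1 = m + n := ⟨m + n - 1, by omega⟩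
      rw [compRight_graft (i + j) z v (compRight_mem hlt hq ha hy) hb, if_pos (by omega), iha hlt]
    · obtain ⟨q, hq⟩ : ∃ q, q + 1 = m' + n := ⟨m' + n - 1, by omega⟩
      rw [compRight_graft (i + j) z v ha (compRight_mem (by omega) hq hb hy),
        if_neg (by omega), ← ihb (by omega)]
      congr 2
      congr 1
      omega

theorem compRight_par {m n p : ℕ} {i j q : ℕ} (hij : i < j) (hj : j < m) (hq : q + 1 = j + n)
    {x y z : FreeTotal k V} (hx : x ∈ arity k V m) (hy : y ∈ arity k V n)
    (hz : z ∈ arity k V p) :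
    compRight q z (compRight i y x) = compRight i y (compRight j z x) := by
  revert i j q
  refine arity_induction (p := fun m x => ∀ {i j q : ℕ}, i < j → j < m → q + 1 = j + n →
    compRight q z (compRight i y x) = compRight i y (compRight j z x)) ?_ ?_ ?_ ?_ hx
  · simp
  · intro m a b ha hb i j q hij hj hq
    simp only [map_add, ha hij hj hq, hb hij hj hq]
  · intro c i j q hij hj hq
    omega
  · intro m m' v a b ha hb iha ihb i j q hij hj hq
    rw [compRight_graft i y v ha hb, compRight_graft j z v ha hb]
    by_cases hi : i < m
    · obtain ⟨s, hs⟩ : ∃ s, s + 1 = m + n := ⟨m + n - 1, by omega⟩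
      rw [if_pos hi, compRight_graft q z v (compRight_mem hi hs ha hy) hb]
      by_cases hjm : j < m
      · obtain ⟨s', hs'⟩ : ∃ s', s' + 1 = m + p := ⟨m + p - 1, by omega⟩
        rw [if_pos (by omega), if_pos hjm,
          compRight_graft i y v (compRight_mem hjm hs' ha hz) hb, if_pos (by omega),
          iha hij hjm hq]
      · obtain ⟨s', hs'⟩ : ∃ s', s' + 1 = m' + p := ⟨m' + p - 1, by omega⟩
        rw [if_neg (by omega), if_neg hjm,
          compRight_graft i y v ha (compRight_mem (by omega) hs' hb hz), if_pos hi,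
          show q - s = j - m by omega]
    · obtain ⟨s, hs⟩ : ∃ s, s + 1 = m' + n := ⟨m' + n - 1, by omega⟩
      obtain ⟨s', hs'⟩ : ∃ s', s' + 1 = m' + p := ⟨m' + p - 1, by omega⟩
      rw [if_neg hi, if_neg (by omega),
        compRight_graft q z v ha (compRight_mem (by omega) hs hb hy), if_neg (by omega),
        compRight_graft i y v ha (compRight_mem (by omega) hs' hb hz), if_neg hi,
        ihb (i := i - m) (j := j - m) (q := q - m) (by omega) (by omega) (by omega)]

end FreeTotal

variable (k V)

/-- The free nonsymmetric operad `T_ns(V)` on `V`, placed in arity `2`. -/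
def FreeOp : NSOperad.{u, max u v} k where
  obj n := FreeTotal.arity k V n
  one := ⟨FreeTotal.leaf k V, FreeTotal.leaf_mem⟩
  comp i hi h := LinearMap.mk₂ k
    (fun x y => ⟨FreeTotal.compRight i y.1 x.1, FreeTotal.compRight_mem hi h x.2 y.2⟩)
    (fun _ _ _ => Subtype.ext (map_add _ _ _))
    (fun _ _ _ => Subtype.ext (map_smul _ _ _))
    (fun x _ _ => Subtype.ext (FreeTotal.compRight_add_right i _ _ x.2))
    (fun c x _ => Subtype.ext (FreeTotal.compRight_smul_right i c _ x.2))
  one_comp _ _ _ := Subtype.ext (FreeTotal.compRight_leaf _ _)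
  comp_one _ _ _ y := Subtype.ext (FreeTotal.compRight_right_leaf _ y.2)
  comp_seq _ _ hi hj _ _ _ _ _ x y z :=
    Subtype.ext (FreeTotal.compRight_seq hi hj z.1 x.2 y.2)
  comp_par _ _ _ hij hq _ hj _ _ _ _ _ _ x y z :=
    Subtype.ext (FreeTotal.compRight_par hij hj hq x.2 y.2 z.2)

/-- A family of (locally homogeneous) spaces of relations `R_n ⊆ T_ns(V)_n`. -/
abbrev Relations := ∀ n : ℕ, Submodule k (FreeTotal.arity k V n)

variable {k V}

/-- The relations are quadratic: they all lie in arity `3`, the part of `T_ns(V)` spanned by the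
trees with two vertices. -/
def Relations.IsQuadratic (R : Relations k V) : Prop := ∀ n, n ≠ 3 → R n = ⊥

/-- The binary nonsymmetric operad `T_ns(V)/(R)`. -/
def Relations.operad (R : Relations k V) : NSOperad.{u, max u v} k :=
  (FreeOp k V).quotient fun n => (R n : Set (FreeTotal.arity k V n))

/-- Relations concentrated in arity `3`. -/
def Relations.quadratic (R : Submodule k (FreeTotal.arity k V 3)) : Relations k V :=
  fun n => if h : n = 3 then h ▸ R else ⊥

end Free

/-! ## The trisuccessor -/

/-- The three symbols `≺`, `≻`, `·`. -/
inductive TriSym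
  | prec
  | succ
  | dot

section Tri

variable (k) in
/-- The vector space `k≺ ⊕ k≻ ⊕ k·`. -/
abbrev TriSpace : Type u := TriSym → k

variable (k) in
/-- The basis vector of `k≺ ⊕ k≻ ⊕ k·` given by a symbol. -/
def sym (s : TriSym) : TriSpace k := by classical exact Pi.single s 1

variable (k) in
/-- `⋆ = ≺ + ≻ + ·`. -/
def star : TriSpace k := sym k .prec + sym k .succ + sym k .dot

variable (k) (V : Type v) [AddCommGroup V] [Module k V]

/-- The vector space `V ⊗ (k≺ ⊕ k≻ ⊕ k·)`. -/
abbrev Hat : Type (max u v) := V ⊗[k] TriSpace k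

variable {V}

/-- The linear map `ω ↦ ω ⊗ s`. -/
def decorate (s : TriSpace k) : V →ₗ[k] Hat k V := (TensorProduct.mk k V (TriSpace k)).flip s

/-- `τ ↦ τ̂`: the label `ω` of each vertex is replaced by `ω ⊗ ⋆`. -/
def hatTree : (t : PTree) → (TMod k V t →ₗ[k] TMod k (Hat k V) t)
  | .nil => (TMod.leafEquiv k (Hat k V)).symm.toLinearMap ∘ₗ (TMod.leafEquiv k V).toLinearMap
  | .node _ l r =>
    (TMod.nodeEquiv k (Hat k V) l r).symm.toLinearMap ∘ₗ
      TensorProduct.map (decorate k (star k)) (TensorProduct.map (hatTree l) (hatTree r)) ∘ₗ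
        (TMod.nodeEquiv k V l r).toLinearMap

/-- The trisuccessor `TSu_J(τ)` of a tree tensor with respect to a set `J` of leaves (leaves are
numbered from `0`, from left to right). -/
def tsuTree : (J : Finset ℕ) → (t : PTree) → (TMod k V t →ₗ[k] TMod k (Hat k V) t)
  | _, .nil => (TMod.leafEquiv k (Hat k V)).symm.toLinearMap ∘ₗ (TMod.leafEquiv k V).toLinearMap
  | J, .node _ l r =>
    let m := l.numLeaves
    let Jl := J.filter (· < m)
    let Jr := (J.filter (m ≤ ·)).image (· - m)
    (TMod.nodeEquiv k (Hat k V) l r).symm.toLinearMap ∘ₗ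
      (if ∀ j ∈ J, j < m then
        TensorProduct.map (decorate k (sym k .prec))
          (TensorProduct.map (tsuTree Jl l) (hatTree k r))
      else if ∀ j ∈ J, m ≤ j then
        TensorProduct.map (decorate k (sym k .succ))
          (TensorProduct.map (hatTree k l) (tsuTree Jr r))
      else
        TensorProduct.map (decorate k (sym k .dot))
          (TensorProduct.map (tsuTree Jl l) (tsuTree Jr r))) ∘ₗ
        (TMod.nodeEquiv k V l r).toLinearMap

/-- The linear extension of `TSu_J` to `T_ns(V)_n → T_ns(V ⊗ (k≺ ⊕ k≻ ⊕ k·))_n`. -/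
def tsuMap (J : Finset ℕ) (n : ℕ) :
    FreeTotal.arity k V n →ₗ[k] FreeTotal.arity k (Hat k V) n :=
  LinearMap.restrict (DirectSum.lmap (tsuTree k J)) (by
    intro x hx t ht
    rw [DirectSum.lmap_apply, hx t ht, map_zero])

variable {k}

/-- The relations of the trisuccessor, spanned by the `TSu_J(r)` for `r` a relation of arity `n`
and `J` a nonempty set of leaves. -/
def Relations.tsu (R : Relations k V) : Relations k (Hat k V) := fun n =>
  Submodule.span k {x | ∃ J : Finset ℕ, J.Nonempty ∧ J ⊆ Finset.range n ∧
    ∃ r ∈ R n, x = tsuMap k J n r}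

end Tri

/-! ## Black square product and tridendriform operad -/

section Black

variable (k) (V : Type v) [AddCommGroup V] [Module k V]

/-- The linear map sending `a ⊗ b` to the operation `(x b y) a z`. -/
def leftComb : V ⊗[k] V →ₗ[k] FreeTotal.arity k V 3 :=
  TensorProduct.lift (LinearMap.mk₂ k
    (fun a b => ⟨FreeTotal.graft a (FreeTotal.graft b (FreeTotal.leaf k V) (FreeTotal.leaf k V))
        (FreeTotal.leaf k V),
      FreeTotal.graft_mem a (FreeTotal.graft_mem b FreeTotal.leaf_mem FreeTotal.leaf_mem)
        FreeTotal.leaf_mem⟩)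
    (fun a a' b => Subtype.ext (FreeTotal.graft_add_vec a a' _ _))
    (fun c a b => Subtype.ext (FreeTotal.graft_smul_vec c a _ _))
    (fun a b b' => Subtype.ext (by
      simp only [FreeTotal.graft_add_vec, FreeTotal.graft_add_left, Submodule.coe_add]))
    (fun c a b => Subtype.ext (by
      simp only [FreeTotal.graft_smul_vec, FreeTotal.graft_smul_left, Submodule.coe_smul])))

/-- The linear map sending `a ⊗ b` to the operation `x a (y b z)`. -/
def rightComb : V ⊗[k] V →ₗ[k] FreeTotal.arity k V 3 :=
  TensorProduct.lift (LinearMap.mk₂ k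
    (fun a b => ⟨FreeTotal.graft a (FreeTotal.leaf k V)
        (FreeTotal.graft b (FreeTotal.leaf k V) (FreeTotal.leaf k V)),
      FreeTotal.graft_mem a FreeTotal.leaf_mem
        (FreeTotal.graft_mem b FreeTotal.leaf_mem FreeTotal.leaf_mem)⟩)
    (fun a a' b => Subtype.ext (FreeTotal.graft_add_vec a a' _ _))
    (fun c a b => Subtype.ext (FreeTotal.graft_smul_vec c a _ _))
    (fun a b b' => Subtype.ext (by
      simp only [FreeTotal.graft_add_vec, FreeTotal.graft_add_right, Submodule.coe_add]))
    (fun c a b => Subtype.ext (by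
      simp only [FreeTotal.graft_smul_vec, FreeTotal.graft_smul_right, Submodule.coe_smul])))

/-- The identification `(V ⊗ V) ⊕ (V ⊗ V) ≅ T_ns(V)_3` by which a pair `(f, g)`, with
`f = ∑ aᵢ ⊗ bᵢ` and `g = ∑ cⱼ ⊗ dⱼ`, encodes the relation
`∑ (x bᵢ y) aᵢ z = ∑ x cⱼ (y dⱼ z)`, that is the element
`∑ (x bᵢ y) aᵢ z - ∑ x cⱼ (y dⱼ z)`. -/
def pairRel : (V ⊗[k] V) × (V ⊗[k] V) →ₗ[k] FreeTotal.arity k V 3 :=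
  leftComb k V ∘ₗ LinearMap.fst k _ _ - rightComb k V ∘ₗ LinearMap.snd k _ _

variable {k V} {W : Type w} [AddCommGroup W] [Module k W]

/-- The exchange `(V ⊗ V) ⊗ (W ⊗ W) → (V ⊗ W) ⊗ (V ⊗ W)` on both components:
`((f₁, g₁), (f₂, g₂)) ↦ (f₁ ⊡ f₂, g₁ ⊡ g₂)`, where
`(a ⊗ b) ⊡ (a' ⊗ b') = (a ⊗ a') ⊗ (b ⊗ b')`. -/
def boxPair (p : (V ⊗[k] V) × (V ⊗[k] V)) (q : (W ⊗[k] W) × (W ⊗[k] W)) :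
    ((V ⊗[k] W) ⊗[k] (V ⊗[k] W)) × ((V ⊗[k] W) ⊗[k] (V ⊗[k] W)) :=
  (TensorProduct.tensorTensorTensorComm k V V W W (p.1 ⊗ₜ q.1),
    TensorProduct.tensorTensorTensorComm k V V W W (p.2 ⊗ₜ q.2))

/-- The relations of the black square product `T_ns(V)/(R) ■ T_ns(W)/(S)` of two binary quadratic
nonsymmetric operads, on the space of generators `V ⊗ W`. -/
def Relations.blackSquare (R : Relations k V) (S : Relations k W) : Relations k (V ⊗[k] W) :=
  Relations.quadratic (Submodule.span k {x | ∃ p q, pairRel k V p ∈ R 3 ∧ pairRel k W q ∈ S 3 ∧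
    x = pairRel k (V ⊗[k] W) (boxPair p q)})

variable (k)

/-- The relations of the operad `TriDend` of tridendriform algebras. -/
def triDend : Relations k (TriSpace k) :=
  let P := sym k .prec
  let S := sym k .succ
  let D := sym k .dot
  let L := fun a b => leftComb k (TriSpace k) (a ⊗ₜ b)
  let R := fun a b => rightComb k (TriSpace k) (a ⊗ₜ b)
  Relations.quadratic (Submodule.span k {
    -- `(x ≺ y) ≺ z = x ≺ (y ⋆ z)`
    L P P - R P (star k),
    -- `(x ≻ y) ≺ z = x ≻ (y ≺ z)`
    L P S - R S P,
    -- `(x ⋆ y) ≻ z = x ≻ (y ≻ z)`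
    L S (star k) - R S S,
    -- `(x ≻ y) · z = x ≻ (y · z)`
    L D S - R S D,
    -- `(x ≺ y) · z = x · (y ≻ z)`
    L D P - R D S,
    -- `(x · y) ≺ z = x · (y ≺ z)`
    L P D - R D P,
    -- `(x · y) · z = x · (y · z)`
    L D D - R D D })

end Black

end NSOp
end

/-!
# The trisuccessor is the black square product with the tridendriform operad

Both operads are quotients of free operads, on `V ⊗ k{≺,≻,·}` and on `k{≺,≻,·} ⊗ V`. The exchange of
the tensor factors induces an isomorphism of these free operads, and it descends to the quotients as
soon as it matches the relations (`NSOperad.Iso.quotient`). The relations are concentrated in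
arity `3`, so everything takes place on the two planar binary trees with two vertices.

For a nonempty set `J` of leaves, `TSu_J` tensors the labels of each of these two trees with fixed
elements of `k{≺,≻,·}` that depend only on `J`; recording them in a pair `triPair k J`, one gets
`TSu_J [f, g] = triPair k J ⊡ [f, g]` (`arityCongr_tsuMap_pairRel`). As `J` runs over the seven
nonempty subsets of the three leaves, the pairs `triPair k J` are exactly the seven tridendriform
relations (`triDend_three`): `TriDend` is the trisuccessor of the associative operad. Hence the
relations `TSu_J r` of the trisuccessor are black square products of a tridendriform relation with
a relation of the given operad. Conversely, the encoding `[f, g]` is bijective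
(`pairRel_injective`, `pairRel_surjective`), so every pair encoding a tridendriform relation is a
combination of the `triPair k J`, and bilinearity of `⊡` shows that nothing else is in the span of
the black square relations.
-/

noncomputable section

namespace NSOp

universe u v w x

/-! ### Isomorphisms of operads and of their quotients -/

section Iso

variable {k : Type u} [Field k] {P : NSOperad.{u, w} k} {Q : NSOperad.{u, x} k}

namespace NSOperad

/-- The inverse of an isomorphism of nonsymmetric operads. -/
def Iso.symm (e : P.Iso Q) : Q.Iso P where
  toEquiv n := (e.toEquiv n).symm
  map_one := by rw [LinearEquiv.symm_apply_eq, e.map_one]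
  map_comp i hi h x y := by
    rw [LinearEquiv.symm_apply_eq, e.map_comp, LinearEquiv.apply_symm_apply,
      LinearEquiv.apply_symm_apply]

theorem InIdeal.map (e : P.Iso Q) {S : ∀ n, Set (P.obj n)} {T : ∀ n, Set (Q.obj n)}
    (hST : ∀ n, ∀ x ∈ S n, e.toEquiv n x ∈ T n) {n : ℕ} {x : P.obj n} (hx : P.InIdeal S n x) :
    Q.InIdeal T n (e.toEquiv n x) := by
  induction hx with
  | of hx => exact .of (hST _ _ hx)
  | zero n => rw [map_zero]; exact .zero n
  | add _ _ hx hy => rw [map_add]; exact .add hx hy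
  | smul c _ hx => rw [map_smul]; exact .smul c hx
  | comp_left i hi h y _ hx => rw [e.map_comp]; exact .comp_left i hi h _ hx
  | comp_right i hi h x _ hy => rw [e.map_comp]; exact .comp_right i hi h _ hy

theorem Iso.map_ideal (e : P.Iso Q) {S : ∀ n, Set (P.obj n)} {T : ∀ n, Set (Q.obj n)}
    (hST : ∀ n, e.toEquiv n '' S n = T n) (n : ℕ) :
    (P.ideal S n).map (e.toEquiv n).toLinearMap = Q.ideal T n := by
  refine le_antisymm (Submodule.map_le_iff_le_comap.2 fun x hx => ?_) fun y hy => ?_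
  · exact InIdeal.map e (fun n x hx => hST n ▸ Set.mem_image_of_mem _ hx) hx
  · refine ⟨(e.toEquiv n).symm y, InIdeal.map e.symm (fun n y hy => ?_) hy,
      (e.toEquiv n).apply_symm_apply y⟩
    obtain ⟨x, hx, rfl⟩ := (hST n).symm ▸ hy
    exact ((e.toEquiv n).symm_apply_apply x).symm ▸ hx

/-- An isomorphism of operads that matches two families of relations descends to the quotients by
the ideals they generate. -/
def Iso.quotient (e : P.Iso Q) {S : ∀ n, Set (P.obj n)} {T : ∀ n, Set (Q.obj n)}
    (hST : ∀ n, e.toEquiv n '' S n = T n) : (P.quotient S).Iso (Q.quotient T) where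
  toEquiv n := Submodule.Quotient.equiv (P.ideal S n) (Q.ideal T n) (e.toEquiv n)
    (e.map_ideal hST n)
  map_one := congrArg Submodule.Quotient.mk e.map_one
  map_comp i hi h x y := by
    induction x using Submodule.Quotient.induction_on with
    | H x =>
    induction y using Submodule.Quotient.induction_on with
    | H y => exact congrArg Submodule.Quotient.mk (e.map_comp i hi h x y)

end NSOperad

end Iso

/-! ### Functoriality of the free operad -/

section Functoriality

variable {k : Type u} [Field k] {V : Type v} [AddCommGroup V] [Module k V]
  {W : Type w} [AddCommGroup W] [Module k W]

/-- The isomorphism `t[V] ≃ t[W]` applying `e : V ≃ W` to the label of each vertex. -/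
def TMod.congr (e : V ≃ₗ[k] W) : (t : PTree) → TMod k V t ≃ₗ[k] TMod k W t
  | .nil => TMod.leafEquiv k V ≪≫ₗ (TMod.leafEquiv k W).symm
  | .node _ l r => TMod.nodeEquiv k V l r ≪≫ₗ
      TensorProduct.congr e (TensorProduct.congr (TMod.congr e l) (TMod.congr e r)) ≪≫ₗ
        (TMod.nodeEquiv k W l r).symm

namespace FreeTotal

/-- The isomorphism of total spaces of free operads applying `e : V ≃ W` to all labels. -/
def congr (e : V ≃ₗ[k] W) : FreeTotal k V ≃ₗ[k] FreeTotal k W :=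
  DirectSum.congrLinearEquiv (TMod.congr e)

theorem congr_incl (e : V ≃ₗ[k] W) (t : PTree) (a : TMod k V t) :
    congr e (incl t a) = incl t (TMod.congr e t a) :=
  DirectSum.lmap_lof (fun t => (TMod.congr e t).toLinearMap) t a

theorem congr_leaf (e : V ≃ₗ[k] W) : congr e (leaf k V) = leaf k W := by
  refine (congr_incl e .nil _).trans ?_
  simp [TMod.congr, leaf, incl]

/-- Every element of the free operad is a sum of tree tensors. -/
theorem induction_incl {p : FreeTotal k V → Prop} (h0 : p 0)
    (ha : ∀ x y, p x → p y → p (x + y)) (hi : ∀ t (a : TMod k V t), p (incl t a))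
    (x : FreeTotal k V) : p x := by
  classical
  rw [← DirectSum.sum_support_of x]
  exact Finset.sum_induction _ p ha h0 fun t _ => hi t _

theorem congr_graft (e : V ≃ₗ[k] W) (v : V) (x y : FreeTotal k V) :
    congr e (graft v x y) = graft (e v) (congr e x) (congr e y) := by
  induction x using induction_incl with
  | h0 => simp [graft_zero_left]
  | ha x x' h h' => rw [graft_add_left, map_add, map_add, graft_add_left, h, h']
  | hi l a =>
    induction y using induction_incl with
    | h0 => simp [graft_zero_right]
    | ha y y' h h' => rw [graft_add_right, map_add, map_add, graft_add_right, h, h']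
    | hi r b =>
      rw [graftT_incl, congr_incl, congr_incl, congr_incl, graftT_incl]
      simp [TMod.congr]

theorem congr_mem (e : V ≃ₗ[k] W) {n : ℕ} {x : FreeTotal k V} :
    congr e x ∈ arity k W n ↔ x ∈ arity k V n :=
  forall₂_congr fun t _ => (TMod.congr e t).map_eq_zero_iff

theorem congr_compRight (e : V ≃ₗ[k] W) {m : ℕ} (i : ℕ) (y : FreeTotal k V) {x : FreeTotal k V}
    (hx : x ∈ arity k V m) :
    congr e (compRight i y x) = compRight i (congr e y) (congr e x) := by
  revert i
  refine arity_induction (p := fun m x => ∀ i, congr e (compRight i y x) =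
    compRight i (congr e y) (congr e x)) ?_ ?_ ?_ ?_ hx
  · simp
  · intro m a b ha hb i
    simp only [map_add, ha, hb]
  · intro c i
    rw [compRight_smul_leaf, map_smul, map_smul, congr_leaf, compRight_smul_leaf]
  · intro m m' v a b ha hb iha ihb i
    rw [congr_graft, compRight_graft i _ _ ((congr_mem e).2 ha) ((congr_mem e).2 hb),
      compRight_graft i y v ha hb]
    split_ifs
    · rw [congr_graft, iha]
    · rw [congr_graft, ihb]

theorem map_congr_arity (e : V ≃ₗ[k] W) (n : ℕ) :
    (arity k V n).map (congr e).toLinearMap = arity k W n := by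
  ext y
  obtain ⟨x, rfl⟩ := (congr e).surjective y
  exact (Submodule.mem_map_equiv _ (e := congr e)).trans
    (by rw [LinearEquiv.symm_apply_apply, congr_mem])

/-- The isomorphism `T_ns(V)_n ≃ T_ns(W)_n` induced by `e : V ≃ W`. -/
def arityCongr (e : V ≃ₗ[k] W) (n : ℕ) : arity k V n ≃ₗ[k] arity k W n :=
  (congr e).ofSubmodules _ _ (map_congr_arity e n)

@[simp]
theorem coe_arityCongr (e : V ≃ₗ[k] W) (n : ℕ) (x : arity k V n) :
    (arityCongr e n x : FreeTotal k W) = congr e x := rfl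

end FreeTotal

/-- The isomorphism of free operads induced by an isomorphism of spaces of generators. -/
def FreeOp.congr (e : V ≃ₗ[k] W) : (FreeOp k V).Iso (FreeOp k W) where
  toEquiv := FreeTotal.arityCongr e
  map_one := Subtype.ext (FreeTotal.congr_leaf e)
  map_comp i _ _ x y := Subtype.ext (FreeTotal.congr_compRight e i y.1 x.2)

theorem arityCongr_leftComb (e : V ≃ₗ[k] W) (z : V ⊗[k] V) :
    FreeTotal.arityCongr e 3 (leftComb k V z) = leftComb k W (TensorProduct.congr e e z) := by
  induction z with
  | zero => simp
  | add x y hx hy => simp only [map_add, hx, hy]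
  | tmul a b =>
    refine Subtype.ext ?_
    simp [leftComb, FreeTotal.congr_graft, FreeTotal.congr_leaf]

theorem arityCongr_rightComb (e : V ≃ₗ[k] W) (z : V ⊗[k] V) :
    FreeTotal.arityCongr e 3 (rightComb k V z) = rightComb k W (TensorProduct.congr e e z) := by
  induction z with
  | zero => simp
  | add x y hx hy => simp only [map_add, hx, hy]
  | tmul a b =>
    refine Subtype.ext ?_
    simp [rightComb, FreeTotal.congr_graft, FreeTotal.congr_leaf]

end Functoriality

/-! ### The component of arity three -/

section ArityThree

variable (k : Type u) [Field k] (V : Type v) [AddCommGroup V] [Module k V]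

/-- The planar binary tree with one vertex. -/
abbrev cherry : PTree := .node () .nil .nil

/-- The identification of the tensor module of the one-vertex tree with `V`. -/
def TMod.cherryEquiv : TMod k V cherry ≃ₗ[k] V :=
  TMod.nodeEquiv k V .nil .nil ≪≫ₗ
    TensorProduct.congr (.refl k V)
      (TensorProduct.congr (TMod.leafEquiv k V) (TMod.leafEquiv k V) ≪≫ₗ TensorProduct.lid k k) ≪≫ₗ
    TensorProduct.rid k V

/-- The tensor module of the left comb with two vertices is `V ⊗ V`, the root factor first. -/
def TMod.leftCombEquiv : TMod k V (.node () cherry .nil) ≃ₗ[k] V ⊗[k] V :=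
  TMod.nodeEquiv k V cherry .nil ≪≫ₗ
    TensorProduct.congr (.refl k V)
      (TensorProduct.congr (TMod.cherryEquiv k V) (TMod.leafEquiv k V) ≪≫ₗ TensorProduct.rid k V)

/-- The tensor module of the right comb with two vertices is `V ⊗ V`, the root factor first. -/
def TMod.rightCombEquiv : TMod k V (.node () .nil cherry) ≃ₗ[k] V ⊗[k] V :=
  TMod.nodeEquiv k V .nil cherry ≪≫ₗ
    TensorProduct.congr (.refl k V)
      (TensorProduct.congr (TMod.leafEquiv k V) (TMod.cherryEquiv k V) ≪≫ₗ TensorProduct.lid k V)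

variable {k V}

theorem FreeTotal.graft_leaf_leaf (v : V) :
    FreeTotal.graft v (FreeTotal.leaf k V) (FreeTotal.leaf k V) =
      FreeTotal.incl cherry ((TMod.cherryEquiv k V).symm v) := by
  refine (FreeTotal.graftT_incl v .nil .nil _ _).trans ?_
  simp [TMod.cherryEquiv]

theorem coe_leftComb (z : V ⊗[k] V) :
    (leftComb k V z : FreeTotal k V) =
      FreeTotal.incl (.node () cherry .nil) ((TMod.leftCombEquiv k V).symm z) := by
  induction z with
  | zero => simp
  | add x y hx hy => simp only [map_add, Submodule.coe_add, hx, hy]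
  | tmul a b =>
    simp only [leftComb, TensorProduct.lift.tmul, LinearMap.mk₂_apply]
    rw [FreeTotal.graft_leaf_leaf]
    refine (FreeTotal.graftT_incl a cherry .nil _ _).trans ?_
    simp [TMod.leftCombEquiv]

theorem coe_rightComb (z : V ⊗[k] V) :
    (rightComb k V z : FreeTotal k V) =
      FreeTotal.incl (.node () .nil cherry) ((TMod.rightCombEquiv k V).symm z) := by
  induction z with
  | zero => simp
  | add x y hx hy => simp only [map_add, Submodule.coe_add, hx, hy]
  | tmul a b =>
    simp only [rightComb, TensorProduct.lift.tmul, LinearMap.mk₂_apply]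
    rw [FreeTotal.graft_leaf_leaf]
    refine (FreeTotal.graftT_incl a .nil cherry _ _).trans ?_
    simp [TMod.rightCombEquiv]

theorem FreeTotal.incl_apply_self (t : PTree) (a : TMod k V t) : FreeTotal.incl t a t = a :=
  DirectSum.of_eq_same (β := fun t => TMod k V t) t a

theorem FreeTotal.incl_apply_of_ne {s t : PTree} (h : s ≠ t) (a : TMod k V t) :
    FreeTotal.incl t a s = 0 :=
  DirectSum.of_eq_of_ne _ _ _ h

theorem PTree.eq_nil_of_numLeaves {t : PTree} (h : t.numLeaves = 1) : t = .nil := by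
  cases t with
  | nil => rfl
  | node _ l r =>
    have := l.numLeaves_pos
    have := r.numLeaves_pos
    simp only [BinaryTree.numLeaves] at h
    omega

theorem PTree.eq_cherry_of_numLeaves {t : PTree} (h : t.numLeaves = 2) : t = cherry := by
  cases t with
  | nil => simp [BinaryTree.numLeaves] at h
  | node _ l r =>
    have := l.numLeaves_pos
    have := r.numLeaves_pos
    simp only [BinaryTree.numLeaves] at h
    rw [eq_nil_of_numLeaves (t := l) (by omega), eq_nil_of_numLeaves (t := r) (by omega)]

theorem PTree.eq_comb_of_numLeaves {t : PTree} (h : t.numLeaves = 3) :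
    t = .node () cherry .nil ∨ t = .node () .nil cherry := by
  cases t with
  | nil => simp [BinaryTree.numLeaves] at h
  | node _ l r =>
    have := l.numLeaves_pos
    have := r.numLeaves_pos
    simp only [BinaryTree.numLeaves] at h
    obtain h' | h' : l.numLeaves = 2 ∨ r.numLeaves = 2 := by omega
    · left
      rw [eq_cherry_of_numLeaves h', eq_nil_of_numLeaves (t := r) (by omega)]
    · right
      rw [eq_cherry_of_numLeaves h', eq_nil_of_numLeaves (t := l) (by omega)]

theorem coe_pairRel (p : (V ⊗[k] V) × (V ⊗[k] V)) :
    (pairRel k V p : FreeTotal k V) =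
      FreeTotal.incl (.node () cherry .nil) ((TMod.leftCombEquiv k V).symm p.1) -
        FreeTotal.incl (.node () .nil cherry) ((TMod.rightCombEquiv k V).symm p.2) := by
  rw [← coe_leftComb, ← coe_rightComb]
  rfl

theorem pairRel_injective : Function.Injective (pairRel k V) := by
  refine (injective_iff_map_eq_zero _).2 fun p hp => ?_
  have h := coe_pairRel p
  rw [hp, Submodule.coe_zero] at h
  have hne : (.node () cherry .nil : PTree) ≠ .node () .nil cherry := by simp
  have h1 := congrArg (fun x : FreeTotal k V => x (.node () cherry .nil)) h
  have h2 := congrArg (fun x : FreeTotal k V => x (.node () .nil cherry)) h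
  simp only [DirectSum.sub_apply, DirectSum.zero_apply, FreeTotal.incl_apply_self,
    FreeTotal.incl_apply_of_ne hne, FreeTotal.incl_apply_of_ne hne.symm, sub_zero, zero_sub] at h1 h2
  refine Prod.ext ?_ ?_
  · exact (LinearEquiv.map_eq_zero_iff _).1 h1.symm
  · exact (LinearEquiv.map_eq_zero_iff _).1 (neg_eq_zero.1 h2.symm)

theorem pairRel_surjective : Function.Surjective (pairRel k V) := by
  rintro ⟨x, hx⟩
  suffices h : ∃ p, (pairRel k V p : FreeTotal k V) = x from h.imp fun p hp => Subtype.ext hp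
  refine FreeTotal.arity_induction_incl
    (p := fun x => ∃ p, (pairRel k V p : FreeTotal k V) = x) ?_ ?_ ?_ x hx
  · exact ⟨0, by simp⟩
  · rintro _ _ ⟨p, rfl⟩ ⟨q, rfl⟩
    exact ⟨p + q, by simp⟩
  · intro t ht a
    obtain rfl | rfl := PTree.eq_comb_of_numLeaves ht
    · exact ⟨(TMod.leftCombEquiv k V a, 0), by simp [coe_pairRel]⟩
    · exact ⟨(0, -TMod.rightCombEquiv k V a), by simp [coe_pairRel]⟩

end ArityThree

/-! ### The trisuccessor of a quadratic element -/

section TSu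

/-- The symbol by which `TSu_J` decorates a root whose left subtree has `m` leaves. -/
def cutSym (m : ℕ) (J : Finset ℕ) : TriSym :=
  if ∀ j ∈ J, j < m then .prec else if ∀ j ∈ J, m ≤ j then .succ else .dot

/-- The leaves in `J` of the left subtree, when that subtree has `m` leaves. -/
def leftLeaves (m : ℕ) (J : Finset ℕ) : Finset ℕ := J.filter (· < m)

/-- The leaves in `J` of the right subtree, renumbered from `0`, when the left subtree has `m`
leaves. -/
def rightLeaves (m : ℕ) (J : Finset ℕ) : Finset ℕ := (J.filter (m ≤ ·)).image (· - m)

variable (k : Type u) [Field k] {V : Type v} [AddCommGroup V] [Module k V]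

variable (V) in
/-- The map `τ ↦ τ̂` on the total space of the free operad. -/
def hatTotal : FreeTotal k V →ₗ[k] FreeTotal k (Hat k V) := DirectSum.lmap (hatTree k)

variable (V) in
/-- The map `TSu_J` on the total space of the free operad. -/
def tsuTotal (J : Finset ℕ) : FreeTotal k V →ₗ[k] FreeTotal k (Hat k V) :=
  DirectSum.lmap (tsuTree k J)

theorem hatTotal_incl (t : PTree) (a : TMod k V t) :
    hatTotal k V (FreeTotal.incl t a) = FreeTotal.incl t (hatTree k t a) :=
  DirectSum.lmap_lof (hatTree k) t a

theorem tsuTotal_incl (J : Finset ℕ) (t : PTree) (a : TMod k V t) :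
    tsuTotal k V J (FreeTotal.incl t a) = FreeTotal.incl t (tsuTree k J t a) :=
  DirectSum.lmap_lof (tsuTree k J) t a

theorem hatTotal_leaf : hatTotal k V (FreeTotal.leaf k V) = FreeTotal.leaf k (Hat k V) := by
  refine (hatTotal_incl k .nil _).trans ?_
  simp [hatTree, FreeTotal.leaf, FreeTotal.incl]

theorem tsuTotal_leaf (J : Finset ℕ) :
    tsuTotal k V J (FreeTotal.leaf k V) = FreeTotal.leaf k (Hat k V) := by
  refine (tsuTotal_incl k J .nil _).trans ?_
  simp [tsuTree, FreeTotal.leaf, FreeTotal.incl]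

theorem hatTotal_graft (v : V) (x y : FreeTotal k V) :
    hatTotal k V (FreeTotal.graft v x y) =
      FreeTotal.graft (decorate k (star k) v) (hatTotal k V x) (hatTotal k V y) := by
  induction x using FreeTotal.induction_incl with
  | h0 => simp [FreeTotal.graft_zero_left]
  | ha x x' h h' =>
    rw [FreeTotal.graft_add_left, map_add, map_add, FreeTotal.graft_add_left, h, h']
  | hi l a =>
    induction y using FreeTotal.induction_incl with
    | h0 => simp [FreeTotal.graft_zero_right]
    | ha y y' h h' =>
      rw [FreeTotal.graft_add_right, map_add, map_add, FreeTotal.graft_add_right, h, h']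
    | hi r b =>
      rw [FreeTotal.graftT_incl, hatTotal_incl, hatTotal_incl, hatTotal_incl,
        FreeTotal.graftT_incl]
      simp [hatTree]

/-- The recursion defining `TSu_J` for nonempty `J`, in terms of grafting. -/
theorem tsuTotal_graft {J : Finset ℕ} (hJ : J.Nonempty) (v : V) {m : ℕ} {x : FreeTotal k V}
    (hx : x ∈ FreeTotal.arity k V m) (y : FreeTotal k V) :
    tsuTotal k V J (FreeTotal.graft v x y) =
      FreeTotal.graft (decorate k (sym k (cutSym m J)) v)
        (if ∀ j ∈ J, m ≤ j then hatTotal k V x else tsuTotal k V (leftLeaves m J) x)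
        (if ∀ j ∈ J, j < m then hatTotal k V y else tsuTotal k V (rightLeaves m J) y) := by
  refine FreeTotal.arity_induction_incl (n := m)
    (p := fun x => tsuTotal k V J (FreeTotal.graft v x y) =
      FreeTotal.graft (decorate k (sym k (cutSym m J)) v)
        (if ∀ j ∈ J, m ≤ j then hatTotal k V x else tsuTotal k V (leftLeaves m J) x)
        (if ∀ j ∈ J, j < m then hatTotal k V y else tsuTotal k V (rightLeaves m J) y))
    ?_ ?_ ?_ x hx
  · simp [FreeTotal.graft_zero_left]
  · intro x x' h h'
    rw [FreeTotal.graft_add_left, map_add, h, h', ← FreeTotal.graft_add_left]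
    split_ifs <;> simp
  rintro l rfl a
  induction y using FreeTotal.induction_incl with
  | h0 => simp [FreeTotal.graft_zero_right]
  | ha y y' h h' =>
    rw [FreeTotal.graft_add_right, map_add, h, h', ← FreeTotal.graft_add_right]
    split_ifs <;> simp
  | hi r b =>
    rw [FreeTotal.graftT_incl, tsuTotal_incl, tsuTotal_incl, tsuTotal_incl, hatTotal_incl,
      hatTotal_incl]
    by_cases h₁ : ∀ j ∈ J, j < l.numLeaves
    · have h₂ : ¬ ∀ j ∈ J, l.numLeaves ≤ j := fun h => by
        obtain ⟨j, hj⟩ := hJ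
        exact absurd (h₁ j hj) (not_lt.2 (h j hj))
      rw [if_neg h₂, if_pos h₁, FreeTotal.graftT_incl, cutSym, if_pos h₁, tsuTree]
      simp only [if_pos h₁]
      simp [leftLeaves]
    · by_cases h₂ : ∀ j ∈ J, l.numLeaves ≤ j
      · rw [if_pos h₂, if_neg h₁, FreeTotal.graftT_incl, cutSym, if_neg h₁, if_pos h₂, tsuTree]
        simp only [if_neg h₁, if_pos h₂]
        simp [rightLeaves]
      · rw [if_neg h₂, if_neg h₁, FreeTotal.graftT_incl, cutSym, if_neg h₁, if_neg h₂, tsuTree]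
        simp only [if_neg h₁, if_neg h₂]
        simp [leftLeaves, rightLeaves]

theorem tsuTotal_graft_leaf_leaf {J : Finset ℕ} (hJ : J.Nonempty) (v : V) :
    tsuTotal k V J (FreeTotal.graft v (FreeTotal.leaf k V) (FreeTotal.leaf k V)) =
      FreeTotal.graft (decorate k (sym k (cutSym 1 J)) v)
        (FreeTotal.leaf k (Hat k V)) (FreeTotal.leaf k (Hat k V)) := by
  rw [tsuTotal_graft k hJ v FreeTotal.leaf_mem]
  simp [hatTotal_leaf, tsuTotal_leaf]

/-- The pair of decorations that `TSu_J` puts on the two-vertex trees, as an element of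
`(k{≺,≻,·} ⊗ k{≺,≻,·})²`: first for the left comb, then for the right comb, each with the root
factor first. -/
def triPair (J : Finset ℕ) :
    (TriSpace k ⊗[k] TriSpace k) × (TriSpace k ⊗[k] TriSpace k) :=
  (sym k (cutSym 2 J) ⊗ₜ
      (if ∀ j ∈ J, 2 ≤ j then star k else sym k (cutSym 1 (leftLeaves 2 J))),
    sym k (cutSym 1 J) ⊗ₜ
      (if ∀ j ∈ J, j < 1 then star k else sym k (cutSym 1 (rightLeaves 1 J))))

theorem coe_tsuMap (J : Finset ℕ) (n : ℕ) (x : FreeTotal.arity k V n) :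
    (tsuMap k J n x : FreeTotal k (Hat k V)) = tsuTotal k V J x := rfl

variable (V) in
/-- The exchange of the two factors of the space of generators `V ⊗ k{≺,≻,·}`. -/
def hatComm : Hat k V ≃ₗ[k] TriSpace k ⊗[k] V := TensorProduct.comm k V (TriSpace k)

theorem hatComm_decorate (s : TriSpace k) (v : V) : hatComm k V (decorate k s v) = s ⊗ₜ v := rfl

/-- On left combs, `TSu_J` is the `⊡`-product with the left half of `triPair k J`. -/
theorem arityCongr_tsuMap_leftComb {J : Finset ℕ} (hJ : J.Nonempty) (z : V ⊗[k] V) :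
    FreeTotal.arityCongr (hatComm k V) 3 (tsuMap k J 3 (leftComb k V z)) =
      leftComb k _ (TensorProduct.tensorTensorTensorComm k _ _ V V ((triPair k J).1 ⊗ₜ z)) := by
  induction z with
  | zero => simp
  | add x y hx hy => simp only [map_add, TensorProduct.tmul_add, hx, hy]
  | tmul a b =>
    refine Subtype.ext ?_
    simp only [FreeTotal.coe_arityCongr, coe_tsuMap, leftComb, TensorProduct.lift.tmul,
      LinearMap.mk₂_apply, triPair, TensorProduct.tensorTensorTensorComm_tmul]
    rw [tsuTotal_graft k hJ a (FreeTotal.graft_mem b FreeTotal.leaf_mem FreeTotal.leaf_mem)]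
    by_cases h : ∀ j ∈ J, 2 ≤ j
    · simp only [Nat.reduceAdd, if_pos h, hatTotal_graft, hatTotal_leaf, tsuTotal_leaf, ite_self,
        FreeTotal.congr_graft, FreeTotal.congr_leaf, hatComm_decorate]
    · have hne : (leftLeaves 2 J).Nonempty := by
        push Not at h
        obtain ⟨j, hj, hlt⟩ := h
        exact ⟨j, Finset.mem_filter.2 ⟨hj, hlt⟩⟩
      simp only [Nat.reduceAdd, if_neg h, tsuTotal_graft_leaf_leaf k hne, hatTotal_leaf,
        tsuTotal_leaf, ite_self, FreeTotal.congr_graft, FreeTotal.congr_leaf, hatComm_decorate]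

/-- On right combs, `TSu_J` is the `⊡`-product with the right half of `triPair k J`. -/
theorem arityCongr_tsuMap_rightComb {J : Finset ℕ} (hJ : J.Nonempty) (z : V ⊗[k] V) :
    FreeTotal.arityCongr (hatComm k V) 3 (tsuMap k J 3 (rightComb k V z)) =
      rightComb k _ (TensorProduct.tensorTensorTensorComm k _ _ V V ((triPair k J).2 ⊗ₜ z)) := by
  induction z with
  | zero => simp
  | add x y hx hy => simp only [map_add, TensorProduct.tmul_add, hx, hy]
  | tmul a b =>
    refine Subtype.ext ?_
    simp only [FreeTotal.coe_arityCongr, coe_tsuMap, rightComb, TensorProduct.lift.tmul,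
      LinearMap.mk₂_apply, triPair, TensorProduct.tensorTensorTensorComm_tmul]
    rw [tsuTotal_graft k hJ a FreeTotal.leaf_mem]
    by_cases h : ∀ j ∈ J, j < 1
    · simp only [if_pos h, hatTotal_graft, hatTotal_leaf, tsuTotal_leaf, ite_self,
        FreeTotal.congr_graft, FreeTotal.congr_leaf, hatComm_decorate]
    · have hne : (rightLeaves 1 J).Nonempty := by
        push Not at h
        obtain ⟨j, hj, hle⟩ := h
        exact ⟨_, Finset.mem_image_of_mem _ (Finset.mem_filter.2 ⟨hj, hle⟩)⟩
      simp only [if_neg h, tsuTotal_graft_leaf_leaf k hne, hatTotal_leaf,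
        tsuTotal_leaf, ite_self, FreeTotal.congr_graft, FreeTotal.congr_leaf, hatComm_decorate]

/-- Up to the exchange of the factors of the generators, `TSu_J [f, g]` is the black square product
of the relation `triPair k J` with `[f, g]`. -/
theorem arityCongr_tsuMap_pairRel {J : Finset ℕ} (hJ : J.Nonempty)
    (q : (V ⊗[k] V) × (V ⊗[k] V)) :
    FreeTotal.arityCongr (hatComm k V) 3 (tsuMap k J 3 (pairRel k V q)) =
      pairRel k _ (boxPair (triPair k J) q) := by
  simp only [pairRel, LinearMap.sub_apply, LinearMap.comp_apply, LinearMap.fst_apply,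
    LinearMap.snd_apply, map_sub, arityCongr_tsuMap_leftComb k hJ,
    arityCongr_tsuMap_rightComb k hJ, boxPair]

end TSu

/-! ### The tridendriform relations -/

section TriDend

theorem Relations.quadratic_three {k : Type u} [Field k] {V : Type v} [AddCommGroup V]
    [Module k V] (R : Submodule k (FreeTotal.arity k V 3)) : Relations.quadratic R 3 = R := rfl

theorem Relations.quadratic_of_ne {k : Type u} [Field k] {V : Type v} [AddCommGroup V]
    [Module k V] (R : Submodule k (FreeTotal.arity k V 3)) {n : ℕ} (hn : n ≠ 3) :
    Relations.quadratic R n = ⊥ := dif_neg hn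

variable (k : Type u) [Field k]

/-- The nonempty sets of leaves of a tree with three leaves. -/
theorem nonempty_subset_range_three {J : Finset ℕ} :
    J.Nonempty ∧ J ⊆ Finset.range 3 ↔
      J ∈ ({{0}, {1}, {2}, {1, 2}, {0, 2}, {0, 1}, {0, 1, 2}} : Finset (Finset ℕ)) := by
  have h : ({{0}, {1}, {2}, {1, 2}, {0, 2}, {0, 1}, {0, 1, 2}} : Finset (Finset ℕ)) =
      (Finset.range 3).powerset.erase ∅ := by decide
  rw [h, Finset.mem_erase, Finset.mem_powerset, Finset.nonempty_iff_ne_empty]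

/-- The seven tridendriform relations are those of the trisuccessor of the associative operad: one
for each nonempty set of leaves of a tree with three leaves. -/
theorem triDend_three :
    triDend k 3 = (Submodule.span k
      (triPair k '' {J | J.Nonempty ∧ J ⊆ Finset.range 3})).map (pairRel k (TriSpace k)) := by
  rw [triDend, Relations.quadratic_three, Submodule.map_span]
  congr 1
  have h : {J : Finset ℕ | J.Nonempty ∧ J ⊆ Finset.range 3} =
      {{0}, {1}, {2}, {1, 2}, {0, 2}, {0, 1}, {0, 1, 2}} := by
    ext J
    simp [nonempty_subset_range_three]
  simp only [h, Set.image_insert_eq, Set.image_singleton]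
  -- The subsets `J` in `h` are listed in the order of the relations they produce in `triDend`, so
  -- that the two sets agree term by term, by evaluation of `triPair` on concrete finite sets.
  rfl

end TriDend

/-! ### Comparison of the relations -/

section Comparison

variable {k : Type u} [Field k] {V : Type v} [AddCommGroup V] [Module k V]

theorem boxPair_add_left {W : Type w} [AddCommGroup W] [Module k W]
    (p p' : (V ⊗[k] V) × (V ⊗[k] V)) (q : (W ⊗[k] W) × (W ⊗[k] W)) :
    boxPair (p + p') q = boxPair p q + boxPair p' q := by
  simp [boxPair, TensorProduct.add_tmul]

theorem boxPair_smul_left {W : Type w} [AddCommGroup W] [Module k W] (c : k)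
    (p : (V ⊗[k] V) × (V ⊗[k] V)) (q : (W ⊗[k] W) × (W ⊗[k] W)) :
    boxPair (c • p) q = c • boxPair p q := by
  simp [boxPair, ← TensorProduct.smul_tmul']

theorem boxPair_zero_left {W : Type w} [AddCommGroup W] [Module k W]
    (q : (W ⊗[k] W) × (W ⊗[k] W)) : boxPair (0 : (V ⊗[k] V) × (V ⊗[k] V)) q = 0 := by
  simp [boxPair]

/-- The exchange of the factors of the generators carries the relations of the trisuccessor of a
quadratic operad to those of its black square product with `TriDend`. -/
theorem map_tsu_eq_blackSquare {R : Relations k V} (hR : R.IsQuadratic) (n : ℕ) :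
    (R.tsu n).map (FreeTotal.arityCongr (hatComm k V) n).toLinearMap =
      (triDend k).blackSquare R n := by
  by_cases hn : n = 3
  · subst hn
    rw [Relations.blackSquare, Relations.quadratic_three, Relations.tsu, Submodule.map_span]
    refine le_antisymm (Submodule.span_le.2 ?_) (Submodule.span_le.2 ?_)
    · rintro _ ⟨_, ⟨J, hJ, hJ3, r, hr, rfl⟩, rfl⟩
      obtain ⟨q, rfl⟩ := pairRel_surjective r
      refine Submodule.subset_span ⟨triPair k J, q, ?_, hr, arityCongr_tsuMap_pairRel k hJ q⟩
      rw [triDend_three]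
      exact Submodule.mem_map_of_mem (Submodule.subset_span ⟨J, ⟨hJ, hJ3⟩, rfl⟩)
    · rintro _ ⟨p, q, hp, hq, rfl⟩
      -- Since `pairRel` is injective, `p` itself is a combination of the seven pairs `triPair k J`.
      rw [triDend_three] at hp
      obtain ⟨p', hp', hpp'⟩ := hp
      obtain rfl := pairRel_injective hpp'
      clear hpp'
      induction hp' using Submodule.span_induction with
      | mem p hp =>
        obtain ⟨J, ⟨hJ, hJ3⟩, rfl⟩ := hp
        exact Submodule.subset_span
          ⟨_, ⟨J, hJ, hJ3, _, hq, rfl⟩, arityCongr_tsuMap_pairRel k hJ q⟩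
      | zero => rw [boxPair_zero_left, map_zero]; exact zero_mem _
      | add p p' _ _ h h' => rw [boxPair_add_left, map_add]; exact add_mem h h'
      | smul c p _ h => rw [boxPair_smul_left, map_smul]; exact Submodule.smul_mem _ c h
  · rw [Relations.blackSquare, Relations.quadratic_of_ne _ hn, Relations.tsu, Submodule.map_span,
      Submodule.span_eq_bot]
    rintro _ ⟨_, ⟨J, -, -, r, hr, rfl⟩, rfl⟩
    rw [hR n hn, Submodule.mem_bot] at hr
    rw [hr, map_zero, map_zero]

end Comparison

end NSOp
end

theorem theorem3p12 {k : Type*} [Field k] {V : Type*} [AddCommGroup V] [Module k V]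
    (R : NSOp.Relations k V) (hR : R.IsQuadratic) :
    Nonempty (NSOp.NSOperad.Iso (R.tsu.operad) ((NSOp.triDend k).blackSquare R).operad) := by
  refine ⟨(NSOp.FreeOp.congr (NSOp.hatComm k V)).quotient fun n => ?_⟩
  exact congrArg SetLike.coe (NSOp.map_tsu_eq_blackSquare hR n)
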